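/- Let $n\ge 1$. A symmetric convex body in $\mathbb{R}^n$ is a compact convex set $K\subset\mathbb{R}^n$ with non-empty interior and $K=-K$; its polar body is $K^\circ=\{x\in\mathbb{R}^n : \langle x,y\rangle\le 1\ \text{for all } y\in K\}$. For symmetric convex bodies $K,T$ in $\mathbb{R}^n$ and $p>0$, let $d_T$ be the metric of the norm on $\mathbb{R}^n$ whose unit ball is $T$, and put $$\gamma_p(K,T):=\inf\ \sup_{x\in K}\ \sum_{j\ge 0}2^{j/p}\,d_T(x,K_j),\qquad d_T(x,K_j)=\min_{y\in K_j}d_T(x,y),$$ where the infimum runs over all sequences $(K_j)_{j\ge 0}$ of sets with $K_j\subset K$ and $|K_j|=2^{2^j}$ for every $j$. **Theorem.** For every $p>0$ there is a constant $C_p>0$, depending only on $p$, such that for every $n\ge 1$ and any two symmetric convex bodies $K,T$ in $\mathbb{R}^n$, $$\gamma_p(K,T)\ \le\ C_p\,\bigl(\log(1+n)\bigr)^{2+1/p}\,\bigl(\log\log(2+n)\bigr)^{1/p}\,\gamma_p(T^\circ,K^\circ).$$ -/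

import Mathlib

open scoped ENNReal

/-- `IsAdmissible M A`: the sets `A 0, A 1, A 2, …` are subsets of `M` and `A j` has exactly
`2 ^ (2 ^ j)` elements. -/
def IsAdmissible {α : Type*} (M : Set α) (A : ℕ → Finset α) : Prop :=
  ∀ j : ℕ, (A j : Set α) ⊆ M ∧ (A j).card = 2 ^ (2 ^ j)

/-- The distance, for the metric `d`, from the point `x` to the finite set `A`. -/
noncomputable def distToFinset {α : Type*} (d : α → α → ℝ) (x : α) (A : Finset α) : ℝ≥0∞ :=
  ⨅ y ∈ A, ENNReal.ofReal (d x y)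

/-- Talagrand's functional `γ_p (M, d)`, with values in `[0, ∞]`: the infimum over all admissible
`A` of `sup_{x ∈ M} ∑_{j ≥ 0} 2 ^ (j / p) d (x, A j)`. -/
noncomputable def talagrandGamma {α : Type*} (p : ℝ) (M : Set α) (d : α → α → ℝ) : ℝ≥0∞ :=
  ⨅ (A : ℕ → Finset α) (_ : IsAdmissible M A),
    ⨆ x ∈ M, ∑' j : ℕ, (2 : ℝ≥0∞) ^ ((j : ℝ) / p) * distToFinset d x (A j)

/-- The metric `d_T` of the norm whose unit ball is `T`; that norm is the Minkowski gauge of `T`. -/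
noncomputable def bodyDist {E : Type*} [AddCommGroup E] [Module ℝ E] (T : Set E) (x y : E) : ℝ :=
  gauge T (x - y)

/-- `γ_p (K, T) = γ_p (K, d_T)` for two subsets `K`, `T` of a real vector space. -/
noncomputable def bodyGamma {E : Type*} [AddCommGroup E] [Module ℝ E] (p : ℝ) (K T : Set E) :
    ℝ≥0∞ :=
  talagrandGamma p K (bodyDist T)

/-- The polar `L° = {x | ⟨x, y⟩ ≤ 1 for all y ∈ L}`. -/
def polarBody {E : Type*} [NormedAddCommGroup E] [InnerProductSpace ℝ E] (L : Set E) : Set E :=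
  {x | ∀ y ∈ L, inner ℝ x y ≤ 1}

/-- `K` is a convex compact set with non-empty interior and `K = -K`. (The structure `ConvexBody`
only asks for a non-empty convex compact set.) -/
def IsSymmetricConvexBody {n : ℕ} (K : ConvexBody (EuclideanSpace ℝ (Fin n))) : Prop :=
  (interior (K : Set (EuclideanSpace ℝ (Fin n)))).Nonempty ∧ ∀ x ∈ K, -x ∈ K

/-! Suppose `G` exceeds the dual functional. It supplies nets `A i` of `polarBody T` with `2 ^ 2 ^
i` points and error `2 ^ (-i / p) * G`; by polarity, an error `ε` means that `⟪z - z', y⟫` is at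
most `ε` in absolute value for every `y ∈ K`. The core is a duality of covering numbers: N points
for `polarBody T` at scale `δ / (8 * L)` give `N ^ L` points for `K` at scale `δ`, where `L` is of
order `log n`.

For this, compare `T` with a Euclidean norm `‖q ·‖` up to powers of `n`. If `x` is Euclidean-close
to a known centre `c`, replace it by the minimiser `y` over `K` of `‖q (y - c)‖ ^ 2 / 2 + l * gauge
T (x - y)`. The gauge is a supremum over `polarBody T`, so a saddle point gives a dual vector `z`
such that `y` also minimises `‖q (y - c)‖ ^ 2 / 2 - l * ⟪z, y⟫`. Strong convexity makes `q y` stable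
in `z`, and `z` may be rounded to the dual net. Each round halves the Euclidean distance to a known
centre, multiplies the number of centres by N and costs little in `gauge T` (`exists_halving_net`).
After `L` rounds the Euclidean remainder is negligible even after the polynomial loss.

As `L ≤ 2 ^ l`, dual level `i` serves level `i + l` for `K`, at a loss of `8 * L * 2 ^ (l / p)`.
Summing over the `J` levels, `J` of order `log n`, gives `log n` to the power `2 + 1 / p`; beyond
level `J`, coordinate grids have a geometrically small error. -/

/-! ### Polar bodies and gauges. -/

section Polarity

variable {E : Type*} [NormedAddCommGroup E] [InnerProductSpace ℝ E]

theorem zero_mem_nhds_of_convex_symm {s : Set E} (hs : Convex ℝ s) (hne : (interior s).Nonempty)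
    (hsymm : ∀ x ∈ s, -x ∈ s) : s ∈ nhds (0 : E) := by
  obtain ⟨x, hx⟩ := hne
  have hneg : -x ∈ closure s := subset_closure (hsymm x (interior_subset hx))
  have h := hs.combo_interior_closure_mem_interior hx hneg
    (a := 1 / 2) (b := 1 / 2) (by norm_num) (by norm_num) (by norm_num)
  rw [smul_neg, add_neg_cancel] at h
  exact mem_interior_iff_mem_nhds.1 h

theorem convex_polarBody (s : Set E) : Convex ℝ (polarBody s) := by
  intro x hx y hy a b ha hb hab z hz
  rw [inner_add_left, inner_smul_left, inner_smul_left]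
  have h1 := hx z hz
  have h2 := hy z hz
  simp only [conj_trivial]
  nlinarith [mul_le_mul_of_nonneg_left h1 ha, mul_le_mul_of_nonneg_left h2 hb]

theorem isClosed_polarBody (s : Set E) : IsClosed (polarBody s) := by
  have : polarBody s = ⋂ y ∈ s, {x | inner ℝ x y ≤ 1} := by
    ext x; simp [polarBody]
  rw [this]
  exact isClosed_biInter fun y _ => isClosed_le (by fun_prop) continuous_const

theorem zero_mem_polarBody (s : Set E) : (0 : E) ∈ polarBody s := by
  intro y _; simp

theorem neg_mem_polarBody {s : Set E} (hsymm : ∀ x ∈ s, -x ∈ s) {z : E} (hz : z ∈ polarBody s) :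
    -z ∈ polarBody s := by
  intro y hy
  have := hz (-y) (hsymm y hy)
  rwa [inner_neg_right, ← inner_neg_left] at this

theorem polarBody_mem_nhds {s : Set E} (hs : Bornology.IsBounded s) :
    polarBody s ∈ nhds (0 : E) := by
  obtain ⟨M, hM, h⟩ := hs.exists_pos_norm_le
  refine Filter.mem_of_superset (Metric.ball_mem_nhds (0 : E) (inv_pos.2 hM)) fun x hx y hy => ?_
  have hx' : ‖x‖ ≤ M⁻¹ := by simpa using (mem_ball_zero_iff.1 hx).le
  calc inner ℝ x y ≤ ‖x‖ * ‖y‖ := real_inner_le_norm x y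
    _ ≤ M⁻¹ * M := by gcongr; exact h y hy
    _ = 1 := inv_mul_cancel₀ hM.ne'

theorem isBounded_polarBody {s : Set E} (hs : s ∈ nhds (0 : E)) :
    Bornology.IsBounded (polarBody s) := by
  obtain ⟨r, hr, h⟩ := Metric.nhds_basis_closedBall.mem_iff.1 hs
  refine (Metric.isBounded_closedBall (x := (0 : E)) (r := r⁻¹)).subset fun z hz => ?_
  rw [mem_closedBall_zero_iff]
  rcases eq_or_ne z 0 with rfl | h0
  · simpa using hr.le
  have hz0 : 0 < ‖z‖ := norm_pos_iff.2 h0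
  have hmem : (r / ‖z‖) • z ∈ s := h (by
    rw [mem_closedBall_zero_iff, norm_smul, norm_div, norm_norm, Real.norm_of_nonneg hr.le,
      div_mul_cancel₀ _ hz0.ne'])
  have := hz _ hmem
  rw [inner_smul_right, real_inner_self_eq_norm_sq] at this
  rw [← one_div, le_div_iff₀ hr]
  calc ‖z‖ * r = r / ‖z‖ * ‖z‖ ^ 2 := by field_simp
    _ ≤ 1 := this

/-- This is the bipolar theorem: if the gauge were larger, a rescaled `x` would lie outside `s`, and
a separating functional, normalised by its bound `u` on `s`, would be a point of the polar that
violates `h`. -/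
theorem gauge_le_of_inner_le [CompleteSpace E] {s : Set E} (hconv : Convex ℝ s)
    (hclosed : IsClosed s) (hs : s ∈ nhds (0 : E)) {x : E} {τ : ℝ} (hτ : 0 ≤ τ)
    (h : ∀ z ∈ polarBody s, inner ℝ z x ≤ τ) : gauge s x ≤ τ := by
  refine le_of_forall_gt fun t ht => ?_
  by_contra hlt
  have ht0 : 0 < t := hτ.trans_lt ht
  obtain ⟨r, hr1, hr2⟩ := exists_between ht
  have hr0 : 0 < r := hτ.trans_lt hr1
  have hx : r⁻¹ • x ∉ s := by
    intro hmem
    have : gauge s x ≤ r := gauge_le_of_mem hr0.le ⟨r⁻¹ • x, hmem, smul_inv_smul₀ hr0.ne' x⟩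
    linarith
  obtain ⟨f, u, hf, hu⟩ := geometric_hahn_banach_closed_point hconv hclosed hx
  have hu0 : 0 < u := by simpa using hf 0 (mem_of_mem_nhds hs)
  set w := (InnerProductSpace.toDual ℝ E).symm f with hw
  have hwf : ∀ y, inner ℝ w y = f y := fun y => InnerProductSpace.toDual_symm_apply
  have hz : u⁻¹ • w ∈ polarBody s := by
    intro y hy
    rw [inner_smul_left, hwf, conj_trivial, inv_mul_le_iff₀ hu0, mul_one]
    exact (hf y hy).le
  have h1 := h _ hz
  rw [inner_smul_left, hwf, conj_trivial, inv_mul_le_iff₀ hu0] at h1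
  rw [map_smul, smul_eq_mul, lt_inv_mul_iff₀ hr0] at hu
  nlinarith

theorem inner_le_of_gauge_polarBody_le {s : Set E} (hs : Bornology.IsBounded s) {z y : E} {r : ℝ}
    (h : gauge (polarBody s) z ≤ r) (hy : y ∈ s) : inner ℝ z y ≤ r := by
  refine le_of_forall_gt fun t ht => ?_
  obtain ⟨b, hb, hbt, w, hw, rfl⟩ := exists_lt_of_gauge_lt
    (absorbent_nhds_zero (polarBody_mem_nhds hs)) (h.trans_lt ht)
  simp only
  rw [inner_smul_left, conj_trivial]
  have := hw y hy
  nlinarith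

end Polarity

/-! ### Regularised minimisation over `K` and its stability in the dual variable. -/

section MirrorStep

variable {E H : Type*} [NormedAddCommGroup E] [InnerProductSpace ℝ E]
  [NormedAddCommGroup H] [InnerProductSpace ℝ H]

theorem nonneg_of_forall_quadratic_nonneg {a b : ℝ}
    (h : ∀ t : ℝ, 0 < t → t ≤ 1 → 0 ≤ t * a + t ^ 2 * b) : 0 ≤ a := by
  by_contra ha
  push Not at ha
  have hb : 0 < |b| + 1 := by positivity
  set t := min 1 (-a / (2 * (|b| + 1))) with ht
  have ht0 : 0 < t := lt_min one_pos (div_pos (neg_pos.2 ha) (by positivity))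
  have h1 := h t ht0 (min_le_left _ _)
  have h2 : t * (2 * (|b| + 1)) ≤ -a := by
    rw [← le_div_iff₀ (by positivity)]; exact min_le_right _ _
  have h3 : b ≤ |b| := le_abs_self b
  have h4 : 0 ≤ a + t * b := by
    by_contra h5
    push Not at h5
    nlinarith
  nlinarith

/-- The first-order condition at a minimiser of `y ↦ ‖q (y - c)‖ ^ 2 / 2 - ⟪w, y⟫` on `K`. -/
theorem variational_inequality_of_isMinOn {K : Set E} (hK : Convex ℝ K) (q : E →ₗ[ℝ] H)
    (c w : E) {y : E} (hy : y ∈ K)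
    (hmin : ∀ y' ∈ K, ‖q (y - c)‖ ^ 2 / 2 - inner ℝ w y ≤ ‖q (y' - c)‖ ^ 2 / 2 - inner ℝ w y')
    {y' : E} (hy' : y' ∈ K) : inner ℝ w (y' - y) ≤ inner ℝ (q (y - c)) (q (y' - y)) := by
  rw [← sub_nonneg]
  refine nonneg_of_forall_quadratic_nonneg (b := ‖q (y' - y)‖ ^ 2 / 2) fun t ht ht1 => ?_
  have hmem : y + t • (y' - y) ∈ K := hK.add_smul_sub_mem hy hy' ⟨ht.le, ht1⟩
  have h := hmin _ hmem
  have e : y + t • (y' - y) - c = (y - c) + t • (y' - y) := by abel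
  rw [e, map_add, map_smul, norm_add_sq_real, inner_smul_right, norm_smul, inner_add_right,
    inner_smul_right, mul_pow, Real.norm_eq_abs, sq_abs] at h
  nlinarith

theorem exists_variational_inequality [FiniteDimensional ℝ E] {K : Set E} (hK : Convex ℝ K)
    (hcomp : IsCompact K) (hne : K.Nonempty) (q : E →ₗ[ℝ] H) (c w : E) :
    ∃ y ∈ K, ∀ y' ∈ K, inner ℝ w (y' - y) ≤ inner ℝ (q (y - c)) (q (y' - y)) := by
  have hq : Continuous q := q.continuous_of_finiteDimensional
  obtain ⟨y, hy, hmin⟩ := hcomp.exists_isMinOn hne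
    (f := fun y => ‖q (y - c)‖ ^ 2 / 2 - inner ℝ w y) (by fun_prop)
  exact ⟨y, hy, fun y' hy' =>
    variational_inequality_of_isMinOn hK q c w hy (fun z hz => hmin hz) hy'⟩

/-- Each first-order condition is tested at the other point and the two are added. Uniqueness of
minimisers is not needed, so `q` may have a kernel and any selection of minimisers will do. -/
theorem norm_sq_sub_le_of_variational_inequality {K : Set E} (q : E →ₗ[ℝ] H) {c w w' y y' : E}
    (hy : y ∈ K) (hy' : y' ∈ K)
    (h : ∀ x ∈ K, inner ℝ w (x - y) ≤ inner ℝ (q (y - c)) (q (x - y)))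
    (h' : ∀ x ∈ K, inner ℝ w' (x - y') ≤ inner ℝ (q (y' - c)) (q (x - y'))) :
    ‖q (y - y')‖ ^ 2 ≤ inner ℝ (w - w') y - inner ℝ (w - w') y' := by
  have h1 := h y' hy'
  have h2 := h' y hy
  have e : ‖q (y - y')‖ ^ 2 = inner ℝ (q (y - c)) (q (y - y')) - inner ℝ (q (y' - c)) (q (y - y')) := by
    rw [← inner_sub_left, ← map_sub, sub_sub_sub_cancel_right, real_inner_self_eq_norm_sq]
  have e2 : q (y' - y) = -q (y - y') := by rw [← map_neg, neg_sub]
  rw [e2, inner_neg_right] at h1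
  rw [e]
  simp only [inner_sub_left, inner_sub_right] at *
  linarith

theorem convexOn_sq_norm_sub_add_inner {K : Set E} (hK : Convex ℝ K) (q : E →ₗ[ℝ] H)
    (c x z : E) (l : ℝ) :
    ConvexOn ℝ K fun y => ‖q (y - c)‖ ^ 2 / 2 + l * inner ℝ z (x - y) := by
  refine ⟨hK, fun u _ v _ s t hs ht hst => ?_⟩
  obtain rfl : t = 1 - s := by linarith
  have e : q (s • u + (1 - s) • v - c) = s • q (u - c) + (1 - s) • q (v - c) := by
    rw [← map_smul, ← map_smul, ← map_add]; congr 1; module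
  have e2 : x - (s • u + (1 - s) • v) = s • (x - u) + (1 - s) • (x - v) := by module
  have h0 : 0 ≤ ‖q (u - c) - q (v - c)‖ ^ 2 := sq_nonneg _
  rw [norm_sub_sq_real] at h0
  simp only [smul_eq_mul]
  rw [e, e2, norm_add_sq_real, norm_smul, norm_smul, inner_smul_left, inner_smul_right,
    inner_add_right, inner_smul_right, inner_smul_right, Real.norm_of_nonneg hs,
    Real.norm_of_nonneg ht, conj_trivial]
  nlinarith [mul_nonneg (mul_nonneg hs ht) h0]

/-- A saddle point of `‖q (y - c)‖ ^ 2 / 2 + l * ⟪z, x - y⟫` on `K × polarBody T`. -/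
theorem exists_saddle [FiniteDimensional ℝ E] {K T : Set E} (hK : Convex ℝ K)
    (hKc : IsCompact K) (hT : Convex ℝ T) (hTclosed : IsClosed T) (hT0 : T ∈ nhds (0 : E))
    (q : E →ₗ[ℝ] H) (c : E) {x : E} (hx : x ∈ K) {l : ℝ} (hl : 0 < l) :
    ∃ y ∈ K, ∃ z ∈ polarBody T,
      (∀ y' ∈ K, inner ℝ (l • z) (y' - y) ≤ inner ℝ (q (y - c)) (q (y' - y))) ∧
        gauge T (x - y) ≤ ‖q (x - c)‖ ^ 2 / (2 * l) := by
  have : CompleteSpace E := FiniteDimensional.complete ℝ E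
  have : ProperSpace E := FiniteDimensional.proper ℝ E
  have hq : Continuous q := q.continuous_of_finiteDimensional
  have hP : IsCompact (polarBody T) :=
    Metric.isCompact_of_isClosed_isBounded (isClosed_polarBody T) (isBounded_polarBody hT0)
  obtain ⟨y, hy, z, hz, hsad⟩ := Sion.exists_isSaddlePointOn (X := K) (Y := polarBody T)
    (f := fun y z => ‖q (y - c)‖ ^ 2 / 2 + l * inner ℝ z (x - y))
    ⟨x, hx⟩ hK hKc
    (fun z _ => ContinuousOn.lowerSemicontinuousOn (by fun_prop))
    (fun z _ => (convexOn_sq_norm_sub_add_inner hK q c x z l).quasiconvexOn)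
    (convex_polarBody T) ⟨0, zero_mem_polarBody T⟩ hP
    (fun y _ => ContinuousOn.upperSemicontinuousOn (by fun_prop))
    (fun y _ => ConcaveOn.quasiconcaveOn ⟨convex_polarBody T, fun u _ v _ s t _ _ hst => by
      simp only [smul_eq_mul, inner_add_left, inner_smul_left, conj_trivial]
      nlinarith [congrArg (fun r => r * (‖q (y - c)‖ ^ 2 / 2)) hst]⟩)
  refine ⟨y, hy, z, hz, fun y' hy' => ?_, ?_⟩
  · refine variational_inequality_of_isMinOn hK q c (l • z) hy (fun v hv => ?_) hy'
    have := hsad v hv z hz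
    simp only [inner_sub_right, inner_smul_left, conj_trivial] at this ⊢
    linarith
  -- Comparing the saddle value with the competitor `y' = x`, where the linear term vanishes, bounds
  -- `l * ⟪v, x - y⟫` for every `v` in the polar.
  · refine gauge_le_of_inner_le hT hTclosed hT0 (by positivity) fun v hv => ?_
    have := hsad x hx v hv
    simp only [sub_self, inner_zero_right, mul_zero, add_zero] at this
    rw [le_div_iff₀ (by positivity)]
    nlinarith [sq_nonneg ‖q (y - c)‖]

end MirrorStep

/-! ### Auerbach coordinates and grid nets. -/

theorem abs_apply_le_gauge {E : Type*} [AddCommGroup E] [Module ℝ E] {s : Set E}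
    (hs : Absorbent ℝ s) {f : E →ₗ[ℝ] ℝ} (hf : ∀ x ∈ s, |f x| ≤ 1) (x : E) :
    |f x| ≤ gauge s x := by
  refine le_of_forall_gt fun t ht => ?_
  obtain ⟨b, hb, hbt, w, hw, rfl⟩ := exists_lt_of_gauge_lt hs ht
  simp only [map_smul, smul_eq_mul, abs_mul, abs_of_pos hb]
  nlinarith [hf w hw]

/-- Take vectors of `T` with maximal absolute determinant. By Cramer's rule each coordinate of `x ∈
T` is a quotient of determinants, at most 1 in absolute value by maximality; since the basis vectors
lie in `T`, the triangle inequality gives the second bound. -/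
theorem exists_auerbach_functionals {E ι : Type*} [Fintype ι] [NormedAddCommGroup E]
    [NormedSpace ℝ E] [FiniteDimensional ℝ E] (b : Module.Basis ι ℝ E) {T : Set E}
    (hT : Convex ℝ T) (hTc : IsCompact T) (hT0 : T ∈ nhds (0 : E)) (hsymm : ∀ x ∈ T, -x ∈ T) :
    ∃ f : ι → E →ₗ[ℝ] ℝ, (∀ i, ∀ x ∈ T, |f i x| ≤ 1) ∧ ∀ x, gauge T x ≤ ∑ i, |f i x| := by
  classical
  have habs : Absorbent ℝ T := absorbent_nhds_zero hT0
  have hcont : Continuous fun v : ι → E => |b.det v| := by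
    refine continuous_abs.comp ?_
    change Continuous fun v : ι → E => (b.toMatrix v).det
    refine Continuous.matrix_det (continuous_matrix fun i j => ?_)
    change Continuous fun v : ι → E => b.coord i (v j)
    exact (b.coord i).continuous_of_finiteDimensional.comp (continuous_apply j)
  obtain ⟨v, hv, hmax⟩ := (isCompact_univ_pi fun _ : ι => hTc).exists_isMaxOn
    ⟨fun _ => 0, fun _ _ => mem_of_mem_nhds hT0⟩ hcont.continuousOn
  have hdet : b.det v ≠ 0 := by
    obtain ⟨r, hr, hrT⟩ : ∃ r : ℝ, 0 < r ∧ ∀ i, r • b i ∈ T := by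
      have h : ∀ᶠ r in nhds (0 : ℝ), ∀ i, r • b i ∈ T := by
        rw [Filter.eventually_all]
        intro i
        have hc : Continuous fun r : ℝ => r • b i := by fun_prop
        exact hc.continuousAt.eventually (by simpa using hT0)
      obtain ⟨ε, hε, h⟩ := Metric.eventually_nhds_iff.1 h
      refine ⟨ε / 2, by positivity, h ?_⟩
      rw [Real.dist_eq, sub_zero, abs_of_pos (by positivity)]
      linarith
    have h1 := hmax (show (fun i => r • b i) ∈ Set.univ.pi fun _ => T from fun i _ => hrT i)
    have h2 : b.det (fun i => r • b i) = r ^ Fintype.card ι := by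
      rw [show (fun i => r • b i) = fun i => (fun _ => r) i • b i from rfl,
        AlternatingMap.map_smul_univ]
      simp [Module.Basis.det_self]
    intro h0
    simp only [Set.mem_ofPred_eq, h0, h2, abs_zero] at h1
    have : 0 < |r ^ Fintype.card ι| := abs_pos.2 (pow_pos hr _).ne'
    linarith
  obtain ⟨hli, hsp⟩ := b.is_basis_iff_det.2 (isUnit_iff_ne_zero.2 hdet)
  set e := Module.Basis.mk hli hsp.ge with he
  refine ⟨fun i => e.coord i, fun i x hx => ?_, fun x => ?_⟩
  · have h := congrArg (fun g => g x) (b.det_smul_mk_coord_eq_det_update hli hsp.ge i)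
    simp only [LinearMap.smul_apply, smul_eq_mul, MultilinearMap.toLinearMap_apply] at h
    have h1 := hmax (show Function.update v i x ∈ Set.univ.pi fun _ => T by
      intro k _
      rcases eq_or_ne k i with rfl | hk
      · simpa using hx
      · simpa [hk] using hv k trivial)
    simp only [Set.mem_ofPred_eq] at h1
    have h2 : |b.det v * e.coord i x| ≤ |b.det v| := by
      rw [he, h]; exact h1
    rw [abs_mul] at h2
    exact le_of_mul_le_mul_left (by linarith) (abs_pos.2 hdet)
  · conv_lhs => rw [← e.sum_repr x]
    refine (gauge_sum_le hT habs _ _).trans (Finset.sum_le_sum fun i _ => ?_)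
    have hvi : gauge T (e i) ≤ 1 := by
      rw [he, Module.Basis.mk_apply]; exact gauge_le_one_of_mem (hv i trivial)
    have hbal : gauge T (e.repr x i • e i) = |e.repr x i| * gauge T (e i) := by
      rcases le_total 0 (e.repr x i) with h | h
      · rw [gauge_smul_of_nonneg h, abs_of_nonneg h, smul_eq_mul]
      · rw [← gauge_neg hsymm, ← neg_smul, gauge_smul_of_nonneg (neg_nonneg.2 h), abs_of_nonpos h,
          smul_eq_mul]
    rw [hbal, Module.Basis.coord_apply]
    exact mul_le_of_le_one_right (abs_nonneg _) hvi

theorem exists_finset_card_le_of_fintype_map {α β : Type*} [Fintype β] (K : Set α) (φ : α → β) :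
    ∃ C : Finset α, (C : Set α) ⊆ K ∧ C.card ≤ Fintype.card β ∧ ∀ x ∈ K, ∃ c ∈ C, φ c = φ x := by
  classical
  have hfin : (φ '' K).Finite := Set.toFinite _
  have h : ∀ b : φ '' K, ∃ x ∈ K, φ x = b := fun b => b.2
  choose g hg hφ using h
  have : Fintype (φ '' K) := Fintype.ofFinite _
  refine ⟨Finset.univ.image g, ?_, ?_, fun x hx => ?_⟩
  · intro x hx
    obtain ⟨b, -, rfl⟩ := Finset.mem_image.1 (Finset.mem_coe.1 hx)
    exact hg b
  · refine Finset.card_image_le.trans ?_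
    rw [Finset.card_univ]
    exact Fintype.card_le_of_injective _ Subtype.val_injective
  · exact ⟨g ⟨φ x, x, hx, rfl⟩, Finset.mem_image_of_mem _ (Finset.mem_univ _), hφ _⟩

theorem exists_net_of_coordinates {E : Type*} [AddCommGroup E] [Module ℝ E] {n : ℕ} {K T : Set E}
    (f : Fin n → E →ₗ[ℝ] ℝ) (hf : ∀ x, gauge T x ≤ ∑ i, |f i x|) {R : ℝ} (hR : 0 < R)
    (hK : ∀ x ∈ K, ∀ i, |f i x| ≤ R) {M : ℕ} (hM : 0 < M) :
    ∃ C : Finset E, (C : Set E) ⊆ K ∧ C.card ≤ (M + 1) ^ n ∧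
      ∀ x ∈ K, ∃ c ∈ C, gauge T (x - c) ≤ n * (2 * R / M) := by
  have hM' : (0 : ℝ) < M := Nat.cast_pos.2 hM
  -- The floor lies in `0, …, M` on `K`, endpoint included, so the reduction modulo `M + 1` does
  -- nothing there.
  let φ : E → Fin n → Fin (M + 1) := fun x i => Fin.ofNat (M + 1) ⌊(f i x + R) * (M / (2 * R))⌋₊
  obtain ⟨C, hCK, hcard, hC⟩ := exists_finset_card_le_of_fintype_map K φ
  refine ⟨C, hCK, by simpa using hcard, fun x hx => ?_⟩
  obtain ⟨c, hc, hφ⟩ := hC x hx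
  refine ⟨c, hc, (hf _).trans ?_⟩
  have key : ∀ i, |f i (x - c)| ≤ 2 * R / M := by
    intro i
    have hval : ∀ y ∈ K, (φ y i : ℕ) = ⌊(f i y + R) * (M / (2 * R))⌋₊ ∧
        0 ≤ (f i y + R) * (M / (2 * R)) := by
      intro y hy
      have hy' := abs_le.1 (hK y hy i)
      have h0 : 0 ≤ (f i y + R) * (M / (2 * R)) :=
        mul_nonneg (by linarith) (by positivity)
      refine ⟨?_, h0⟩
      simp only [φ, Fin.ofNat]
      refine Nat.mod_eq_of_lt (Nat.lt_succ_of_le (Nat.floor_le_of_le ?_))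
      calc (f i y + R) * (M / (2 * R)) ≤ (2 * R) * (M / (2 * R)) := by
            gcongr; linarith
        _ = M := by field_simp
    obtain ⟨h1, h1'⟩ := hval x hx
    obtain ⟨h2, h2'⟩ := hval c (hCK hc)
    have h3 : ⌊(f i x + R) * (M / (2 * R))⌋₊ = ⌊(f i c + R) * (M / (2 * R))⌋₊ := by
      rw [← h1, ← h2, hφ]
    have a1 := Nat.floor_le h1'
    have a2 := Nat.lt_floor_add_one ((f i x + R) * (M / (2 * R)))
    have a3 := Nat.floor_le h2'
    have a4 := Nat.lt_floor_add_one ((f i c + R) * (M / (2 * R)))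
    rw [h3] at a1 a2
    have h4 : |(f i x - f i c) * (M / (2 * R))| ≤ 1 := by
      rw [abs_le]; constructor <;> nlinarith
    rw [abs_mul, abs_of_pos (by positivity : (0 : ℝ) < M / (2 * R))] at h4
    rw [map_sub, le_div_iff₀ hM']
    have : |f i x - f i c| * (M / (2 * R)) * (2 * R) = |f i x - f i c| * M := by field_simp
    nlinarith
  calc ∑ i, |f i (x - c)| ≤ ∑ _i : Fin n, 2 * R / M := Finset.sum_le_sum fun i _ => key i
    _ = n * (2 * R / M) := by simp

/-! ### Iterated halving and duality of covering numbers. -/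

section Halving

variable {E H : Type*} [NormedAddCommGroup E] [InnerProductSpace ℝ E] [FiniteDimensional ℝ E]
  [NormedAddCommGroup H] [InnerProductSpace ℝ H]

/-- The centres are Euclidean-close not to `x` but to a point `x'` displaced from it by a small
amount in `gauge T`. Each round moves `x'` to a saddle point, which is determined by a centre and a
dual vector up to an error that rounding the dual vector keeps below half the radius. -/
theorem exists_halving_net {K T : Set E} (hK : Convex ℝ K)
    (hKc : IsCompact K) (hK0 : (0 : E) ∈ K) (hT : Convex ℝ T) (hTclosed : IsClosed T)
    (hT0 : T ∈ nhds (0 : E)) (q : E →ₗ[ℝ] H) {ρ : ℝ} (hρ : 0 < ρ) (hq : ∀ x ∈ K, ‖q x‖ ≤ ρ)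
    (S : Finset E) {ε δ : ℝ} {L : ℕ} (hL : 0 < L) (hδ : 0 < δ) (hε : ε ≤ δ / (8 * L))
    (hS : ∀ z ∈ polarBody T, ∃ z' ∈ S, ∀ y ∈ K, |inner ℝ (z - z') y| ≤ ε) (r : ℕ) :
    ∃ C : Finset E, (C : Set E) ⊆ K ∧ C.card ≤ S.card ^ r ∧
      ∀ x ∈ K, ∃ x' ∈ K, ∃ c ∈ C,
        gauge T (x - x') ≤ r * (δ / (2 * L)) ∧ ‖q (x' - c)‖ ≤ ρ / 2 ^ r := by
  classical
  have hL' : (0 : ℝ) < L := Nat.cast_pos.2 hL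
  induction r with
  | zero =>
    refine ⟨{0}, by simpa using hK0, by simp, fun x hx => ⟨x, hx, 0, by simp, by simp, ?_⟩⟩
    simpa using hq x hx
  | succ r ih =>
    obtain ⟨C, hCK, hcard, hC⟩ := ih
    set ρ' := ρ / 2 ^ r with hρ'
    have hρ'0 : 0 < ρ' := by positivity
    -- This weight balances two demands: the displacement `ρ' ^ 2 / (2 * l)` equals `δ / (2 * L)`,
    -- and the stability error `2 * l * ε` is at most `(ρ' / 2) ^ 2`.
    set l := L * ρ' ^ 2 / δ with hl
    have hl0 : 0 < l := by positivity
    have hstep : ∀ c z : E, ∃ y ∈ K, ∀ y' ∈ K,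
        inner ℝ (l • z) (y' - y) ≤ inner ℝ (q (y - c)) (q (y' - y)) := fun c z =>
      exists_variational_inequality hK hKc ⟨0, hK0⟩ q c (l • z)
    choose Y hYK hY using hstep
    refine ⟨(C ×ˢ S).image fun w => Y w.1 w.2, ?_, ?_, fun x hx => ?_⟩
    · intro y hy
      obtain ⟨w, -, rfl⟩ := Finset.mem_image.1 (Finset.mem_coe.1 hy)
      exact hYK _ _
    · refine Finset.card_image_le.trans ?_
      rw [Finset.card_product, pow_succ]
      exact Nat.mul_le_mul_right _ hcard
    obtain ⟨x', hx', c, hc, hgauge, hnorm⟩ := hC x hx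
    obtain ⟨y, hy, z, hz, hvi, hg⟩ := exists_saddle hK hKc hT hTclosed hT0 q c hx' hl0
    obtain ⟨z', hz', hzz'⟩ := hS z hz
    refine ⟨y, hy, Y c z', Finset.mem_image.2 ⟨(c, z'), Finset.mk_mem_product hc hz', rfl⟩, ?_, ?_⟩
    · have h1 : gauge T (x' - y) ≤ δ / (2 * L) := by
        refine hg.trans ?_
        calc ‖q (x' - c)‖ ^ 2 / (2 * l) ≤ ρ' ^ 2 / (2 * l) := by gcongr
          _ = δ / (2 * L) := by rw [hl]; field_simp
      have h2 := gauge_add_le hT (absorbent_nhds_zero hT0) (x - x') (x' - y)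
      rw [sub_add_sub_cancel] at h2
      push_cast
      linarith
    · have h1 := norm_sq_sub_le_of_variational_inequality q hy (hYK c z') hvi (hY c z')
      have h2 := abs_le.1 (hzz' y hy)
      have h3 := abs_le.1 (hzz' _ (hYK c z'))
      rw [← smul_sub, inner_smul_left, inner_smul_left, conj_trivial] at h1
      have h4 : l * (2 * ε) ≤ (ρ' / 2) ^ 2 := by
        calc l * (2 * ε) ≤ l * (2 * (δ / (8 * L))) := by gcongr
          _ = (ρ' / 2) ^ 2 := by rw [hl]; field_simp; norm_num
      have h5 : ‖q (y - Y c z')‖ ^ 2 ≤ (ρ' / 2) ^ 2 := by nlinarith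
      have h6 := abs_le_of_sq_le_sq h5 (by positivity)
      rw [abs_of_nonneg (norm_nonneg _)] at h6
      rw [pow_succ, ← div_div]
      exact h6

/-- Covering numbers of `K` by multiples of `T` in terms of those of `polarBody T` by multiples of
`polarBody K`. -/
theorem exists_net_of_polar_net {K T : Set E} (hK : Convex ℝ K)
    (hKc : IsCompact K) (hK0 : (0 : E) ∈ K) (hT : Convex ℝ T) (hTclosed : IsClosed T)
    (hT0 : T ∈ nhds (0 : E)) (q : E →ₗ[ℝ] H) {ρ A : ℝ} (hρ : 0 < ρ) (hq : ∀ x ∈ K, ‖q x‖ ≤ ρ)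
    (hA : 0 ≤ A) (hqT : ∀ x, gauge T x ≤ A * ‖q x‖)
    (S : Finset E) {ε δ : ℝ} {L : ℕ} (hL : 0 < L) (hδ : 0 < δ) (hε : ε ≤ δ / (8 * L))
    (hδL : 2 * (A * ρ) ≤ 2 ^ L * δ)
    (hS : ∀ z ∈ polarBody T, ∃ z' ∈ S, ∀ y ∈ K, |inner ℝ (z - z') y| ≤ ε) :
    ∃ C : Finset E, (C : Set E) ⊆ K ∧ C.card ≤ S.card ^ L ∧
      ∀ x ∈ K, ∃ c ∈ C, gauge T (x - c) ≤ δ := by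
  have hL' : (0 : ℝ) < L := Nat.cast_pos.2 hL
  obtain ⟨C, hCK, hcard, hC⟩ :=
    exists_halving_net hK hKc hK0 hT hTclosed hT0 q hρ hq S hL hδ hε hS L
  refine ⟨C, hCK, hcard, fun x hx => ?_⟩
  obtain ⟨x', hx', c, hc, h1, h2⟩ := hC x hx
  refine ⟨c, hc, ?_⟩
  have h3 := gauge_add_le hT (absorbent_nhds_zero hT0) (x - x') (x' - c)
  rw [sub_add_sub_cancel] at h3
  have h4 : gauge T (x' - c) ≤ δ / 2 := by
    calc gauge T (x' - c) ≤ A * ‖q (x' - c)‖ := hqT _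
      _ ≤ A * (ρ / 2 ^ L) := by gcongr
      _ = A * ρ / 2 ^ L := by ring
      _ ≤ δ / 2 := by rw [div_le_iff₀ (by positivity)]; linarith
  have h5 : (L : ℝ) * (δ / (2 * L)) = δ / 2 := by field_simp
  linarith

end Halving

/-! ### Passage between the functional and families of nets. -/

section GammaBounds

theorem exists_superset_finset_card_eq {α : Type*} {K : Set α} (hinf : K.Infinite)
    {C : Finset α} (hCK : (C : Set α) ⊆ K) {k : ℕ} (hk : 0 < k) (hcard : C.card ≤ k) :
    ∃ D : Finset α, C ⊆ D ∧ (D : Set α) ⊆ K ∧ D.card = k := by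
  obtain ⟨s, hs1, hs2, hs3⟩ := hinf.exists_superset_ncard_eq hCK C.finite_toSet
    (k := k) (by rwa [Set.ncard_coe_finset])
  have hfin : s.Finite := Set.finite_of_ncard_pos (by rwa [hs3])
  refine ⟨hfin.toFinset, fun x hx => by simpa using hs1 (Finset.mem_coe.2 hx),
    by simpa using hs2, ?_⟩
  rw [← hs3, Set.ncard_eq_toFinset_card s hfin]

variable {E : Type*} [AddCommGroup E] [Module ℝ E]

theorem two_rpow_mul_distToFinset_le {T : Set E} {x c : E} {D : Finset E} {r t : ℝ} (hc : c ∈ D)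
    (h : gauge T (x - c) ≤ t) :
    (2 : ℝ≥0∞) ^ r * distToFinset (bodyDist T) x D ≤ ENNReal.ofReal ((2 : ℝ) ^ r * t) := by
  rw [ENNReal.ofReal_mul (by positivity), ← ENNReal.ofReal_rpow_of_pos (by norm_num),
    ENNReal.ofReal_ofNat]
  have h1 : distToFinset (bodyDist T) x D ≤ ENNReal.ofReal t :=
    (iInf₂_le c hc).trans (ENNReal.ofReal_le_ofReal h)
  gcongr

theorem tsum_le_of_head_tail {F : ℕ → ℝ≥0∞} {s : ℕ → ℝ} {V W : ℝ} (hV : 0 ≤ V) (hW : 0 ≤ W)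
    {J : ℕ} (hF : ∀ j, F j ≤ ENNReal.ofReal (s j)) (h1 : ∀ j < J, s j ≤ V)
    (h2 : ∀ j, s (j + J) ≤ W * (1 / 2) ^ j) :
    ∑' j, F j ≤ ENNReal.ofReal (J * V + 2 * W) := by
  rw [← (ENNReal.summable (f := fun j => F (j + J))).sum_add_tsum_nat_add',
    ENNReal.ofReal_add (mul_nonneg J.cast_nonneg hV) (mul_nonneg zero_le_two hW)]
  refine add_le_add ?_ ?_
  · calc ∑ j ∈ Finset.range J, F j
        ≤ ∑ _j ∈ Finset.range J, ENNReal.ofReal V := Finset.sum_le_sum fun j hj =>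
          (hF j).trans (ENNReal.ofReal_le_ofReal (h1 j (Finset.mem_range.1 hj)))
      _ = ENNReal.ofReal (J * V) := by
          rw [Finset.sum_const, Finset.card_range, nsmul_eq_mul,
            ENNReal.ofReal_mul J.cast_nonneg, ENNReal.ofReal_natCast]
  · have hgeo : HasSum (fun j : ℕ => W * (1 / 2 : ℝ) ^ j) (W * 2) :=
      hasSum_geometric_two.mul_left W
    calc ∑' j, F (j + J) ≤ ∑' j : ℕ, ENNReal.ofReal (W * (1 / 2) ^ j) :=
          ENNReal.tsum_le_tsum fun j => (hF _).trans (ENNReal.ofReal_le_ofReal (h2 j))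
      _ = ENNReal.ofReal (2 * W) := by
          rw [← ENNReal.ofReal_tsum_of_nonneg (fun j => by positivity) hgeo.summable,
            hgeo.tsum_eq, mul_comm]

/-- Upper bound for `bodyGamma` from finite nets, one for each level. -/
theorem bodyGamma_le_of_nets {K T : Set E} (hinf : K.Infinite) {p V W : ℝ} (hV : 0 ≤ V)
    (hW : 0 ≤ W) {J : ℕ} {C : ℕ → Finset E} {τ : ℕ → ℝ} (hCK : ∀ j, (C j : Set E) ⊆ K)
    (hcard : ∀ j, (C j).card ≤ 2 ^ 2 ^ j)
    (hC : ∀ j, ∀ x ∈ K, ∃ c ∈ C j, gauge T (x - c) ≤ τ j)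
    (h1 : ∀ j < J, (2 : ℝ) ^ ((j : ℝ) / p) * τ j ≤ V)
    (h2 : ∀ j : ℕ, (2 : ℝ) ^ (((j + J : ℕ) : ℝ) / p) * τ (j + J) ≤ W * (1 / 2) ^ j) :
    bodyGamma p K T ≤ ENNReal.ofReal (J * V + 2 * W) := by
  classical
  have hex : ∀ j, ∃ D : Finset E, C j ⊆ D ∧ (D : Set E) ⊆ K ∧ D.card = 2 ^ 2 ^ j := fun j =>
    exists_superset_finset_card_eq hinf (hCK j) (by positivity) (hcard j)
  choose D hD1 hD2 hD3 using hex
  refine (iInf₂_le D fun j => ⟨hD2 j, hD3 j⟩).trans (iSup₂_le fun x hx => ?_)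
  have hterm : ∀ j : ℕ, (2 : ℝ≥0∞) ^ ((j : ℝ) / p) * distToFinset (bodyDist T) x (D j) ≤
      ENNReal.ofReal ((2 : ℝ) ^ ((j : ℝ) / p) * τ j) := by
    intro j
    obtain ⟨c, hc, hcx⟩ := hC j x hx
    exact two_rpow_mul_distToFinset_le (hD1 j hc) hcx
  exact tsum_le_of_head_tail hV hW hterm h1 h2

/-- Nets extracted from a bound on `bodyGamma`. -/
theorem exists_nets_of_bodyGamma_lt {K T : Set E} {p G : ℝ}
    (h : bodyGamma p K T < ENNReal.ofReal G) :
    ∃ A : ℕ → Finset E, (∀ j, (A j).card = 2 ^ 2 ^ j) ∧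
      ∀ j, ∀ x ∈ K, ∃ a ∈ A j, gauge T (x - a) ≤ (2 : ℝ) ^ (-((j : ℝ) / p)) * G := by
  have hG : 0 < G := ENNReal.ofReal_pos.1 (bot_le.trans_lt h)
  unfold bodyGamma talagrandGamma at h
  simp only [iInf_lt_iff] at h
  obtain ⟨A, hA, hlt⟩ := h
  refine ⟨A, fun j => (hA j).2, fun j x hx => ?_⟩
  have hne : (A j).Nonempty := by
    rw [← Finset.card_pos, (hA j).2]; positivity
  obtain ⟨a, ha, hmin⟩ := (A j).exists_min_image (fun y => gauge T (x - y)) hne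
  refine ⟨a, ha, ?_⟩
  have h1 : ENNReal.ofReal (gauge T (x - a)) ≤ distToFinset (bodyDist T) x (A j) :=
    le_iInf₂ fun y hy => ENNReal.ofReal_le_ofReal (hmin y hy)
  have h2 : (2 : ℝ≥0∞) ^ ((j : ℝ) / p) * distToFinset (bodyDist T) x (A j) ≤ ENNReal.ofReal G :=
    ((ENNReal.le_tsum j).trans
      (le_iSup₂ (f := fun x (_ : x ∈ K) =>
        ∑' j : ℕ, (2 : ℝ≥0∞) ^ ((j : ℝ) / p) * distToFinset (bodyDist T) x (A j)) x hx)).trans hlt.le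
  have h3 : ENNReal.ofReal ((2 : ℝ) ^ ((j : ℝ) / p) * gauge T (x - a)) ≤ ENNReal.ofReal G := by
    rw [ENNReal.ofReal_mul (by positivity), ← ENNReal.ofReal_rpow_of_pos (by norm_num),
      ENNReal.ofReal_ofNat]
    exact (by gcongr : _ ≤ _).trans h2
  rw [ENNReal.ofReal_le_ofReal_iff hG.le] at h3
  rw [Real.rpow_neg (by norm_num), le_inv_mul_iff₀ (by positivity)]
  exact h3

end GammaBounds

/-- Two balls of radius `r` that cover a symmetric set force its gauge radius to be at most
`2 * r`. -/
theorem gauge_le_two_mul_of_card_le_two {E : Type*} [AddCommGroup E] [Module ℝ E] {P Q : Set E}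
    (hQ : Convex ℝ Q) (habs : Absorbent ℝ Q) (hQsymm : ∀ x ∈ Q, -x ∈ Q) (hP0 : (0 : E) ∈ P)
    (hPsymm : ∀ x ∈ P, -x ∈ P) {A : Finset E} (hA : A.card ≤ 2) {r : ℝ}
    (h : ∀ x ∈ P, ∃ a ∈ A, gauge Q (x - a) ≤ r) {x : E} (hx : x ∈ P) : gauge Q x ≤ 2 * r := by
  obtain ⟨a, ha, h1⟩ := h x hx
  obtain ⟨b, hb, h2⟩ := h 0 hP0
  obtain ⟨c, hc, h3⟩ := h (-x) (hPsymm x hx)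
  -- Among the centres of `x`, `0` and `-x` two coincide, and the corresponding points are at
  -- distance at most `2 * r`.
  have key : ∀ u v w : E, gauge Q (u - w) ≤ r → gauge Q (v - w) ≤ r → gauge Q (u - v) ≤ 2 * r := by
    intro u v w hu hv
    rw [← gauge_neg hQsymm, neg_sub] at hv
    have := gauge_add_le hQ habs (u - w) (w - v)
    rw [sub_add_sub_cancel] at this
    linarith
  by_cases hab : a = b
  · subst hab; simpa using key x 0 a h1 h2
  by_cases hbc : b = c
  · subst hbc; simpa using key 0 (-x) b h2 h3
  by_cases hac : a = c
  · subst hac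
    have h4 := key x (-x) a h1 h3
    have e : x - -x = (2 : ℝ) • x := by rw [sub_neg_eq_add, two_smul]
    have h0 : 0 ≤ gauge Q x := gauge_nonneg x
    rw [e, gauge_smul_of_nonneg (by norm_num), smul_eq_mul] at h4
    linarith
  · classical
    have hsub : ({a, b, c} : Finset E) ⊆ A := by
      intro y hy
      simp only [Finset.mem_insert, Finset.mem_singleton] at hy
      rcases hy with rfl | rfl | rfl <;> assumption
    have := Finset.card_le_card hsub
    rw [Finset.card_eq_three.2 ⟨a, b, c, hab, hac, hbc, rfl⟩] at this
    omega

/-! ### Nets at every level, choice of parameters, and conclusion. -/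

theorem sq_le_two_pow {u : ℕ} (hu : 4 ≤ u) : u ^ 2 ≤ 2 ^ u := by
  induction u, hu using Nat.le_induction with
  | base => norm_num
  | succ u hu ih => rw [pow_succ 2]; nlinarith

theorem two_rpow_div_le {p : ℝ} {a : ℕ} (hpa : 1 / p ≤ a) (j : ℕ) :
    (2 : ℝ) ^ ((j : ℝ) / p) ≤ 2 ^ (a * j) := by
  rw [← Real.rpow_natCast]
  refine Real.rpow_le_rpow_of_exponent_le (by norm_num) ?_
  rw [div_eq_mul_one_div, Nat.cast_mul, mul_comm]
  gcongr

/-- Duality for `bodyGamma` with a loss expressed through integer parameters of order `log n`. -/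
theorem bodyGamma_le_of_bodyGamma_polarBody_lt {n : ℕ} (hn : 1 ≤ n)
    {K T : Set (EuclideanSpace ℝ (Fin n))}
    (hK : Convex ℝ K) (hKc : IsCompact K) (hKi : (interior K).Nonempty) (hKs : ∀ x ∈ K, -x ∈ K)
    (hT : Convex ℝ T) (hTc : IsCompact T) (hTi : (interior T).Nonempty) (hTs : ∀ x ∈ T, -x ∈ T)
    {p G : ℝ} (hp : 0 < p) {a m J L l : ℕ} (hpa : 1 / p ≤ a) (hm : n ≤ 2 ^ m)
    (hJ : J = 2 * m + (2 * a + 5)) (hL : L = 2 * m + a * J) (hl : L ≤ 2 ^ l)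
    (hG : bodyGamma p (polarBody T) (polarBody K) < ENNReal.ofReal G) :
    bodyGamma p K T ≤
      ENNReal.ofReal (J * (8 * L * (2 : ℝ) ^ ((l : ℝ) / p) * G) + 2 * (2 * G)) := by
  have hG0 : 0 < G := ENNReal.ofReal_pos.1 (bot_le.trans_lt hG)
  have ha : 1 ≤ a := by
    have : (0 : ℝ) < a := (one_div_pos.2 hp).trans_le hpa
    exact_mod_cast this
  have hL1 : 1 ≤ L := by rw [hL, hJ]; nlinarith
  have hL1' : (1 : ℝ) ≤ L := by exact_mod_cast hL1
  have hn' : (1 : ℝ) ≤ n := by exact_mod_cast hn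
  have hm' : (n : ℝ) ≤ 2 ^ m := by exact_mod_cast hm
  have hT0 := zero_mem_nhds_of_convex_symm hT hTi hTs
  have hKn := zero_mem_nhds_of_convex_symm hK hKi hKs
  have hK0 : (0 : EuclideanSpace ℝ (Fin n)) ∈ K := mem_of_mem_nhds hKn
  have hTabs : Absorbent ℝ T := absorbent_nhds_zero hT0
  have hPabs : Absorbent ℝ (polarBody K) := absorbent_nhds_zero (polarBody_mem_nhds hKc.isBounded)
  have hinf : K.Infinite := by
    have : Nontrivial (EuclideanSpace ℝ (Fin n)) :=
      have : Nonempty (Fin n) := ⟨⟨0, hn⟩⟩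
      inferInstance
    exact infinite_of_mem_nhds (0 : EuclideanSpace ℝ (Fin n)) hKn
  obtain ⟨A, hAcard, hA⟩ := exists_nets_of_bodyGamma_lt hG
  -- Level 0 of the dual nets has only two points, so it bounds the radius of `polarBody T` with
  -- respect to `polarBody K`; polarity carries this over to `K` and `T`.
  have hrad : ∀ x ∈ K, gauge T x ≤ 2 * G := by
    intro x hx
    refine gauge_le_of_inner_le hT hTc.isClosed hT0 (by positivity) fun z hz => ?_
    refine inner_le_of_gauge_polarBody_le hKc.isBounded ?_ hx
    refine gauge_le_two_mul_of_card_le_two (convex_polarBody K) hPabs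
      (fun _ => neg_mem_polarBody hKs) (zero_mem_polarBody T) (fun _ => neg_mem_polarBody hTs)
      (A := A 0) (by rw [hAcard]; norm_num) ?_ hz
    simpa using hA 0
  obtain ⟨f, hf1, hf2⟩ := exists_auerbach_functionals
    (EuclideanSpace.basisFun (Fin n) ℝ).toBasis hT hTc hT0 hTs
  have hfK : ∀ x ∈ K, ∀ i, |f i x| ≤ 2 * G := fun x hx i =>
    (abs_apply_le_gauge hTabs (hf1 i) x).trans (hrad x hx)
  let q : EuclideanSpace ℝ (Fin n) →ₗ[ℝ] EuclideanSpace ℝ (Fin n) :=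
    (WithLp.linearEquiv 2 ℝ (Fin n → ℝ)).symm.toLinearMap ∘ₗ LinearMap.pi f
  have hqi : ∀ x i, q x i = f i x := fun x i => rfl
  have hqK : ∀ x ∈ K, ‖q x‖ ≤ n * (2 * G) := by
    intro x hx
    rw [EuclideanSpace.norm_eq]
    refine Real.sqrt_le_iff.2 ⟨by positivity, ?_⟩
    calc ∑ i, ‖q x i‖ ^ 2 ≤ ∑ _i : Fin n, (2 * G) ^ 2 := by
          refine Finset.sum_le_sum fun i _ => ?_
          rw [hqi, Real.norm_eq_abs]
          exact pow_le_pow_left₀ (abs_nonneg _) (hfK x hx i) 2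
      _ = n * (2 * G) ^ 2 := by simp
      _ ≤ (n * (2 * G)) ^ 2 := by
          rw [mul_pow (n : ℝ)]
          have : (n : ℝ) ≤ n ^ 2 := by nlinarith
          exact mul_le_mul_of_nonneg_right this (sq_nonneg _)
  have hqT : ∀ x, gauge T x ≤ n * ‖q x‖ := by
    intro x
    refine (hf2 x).trans ?_
    calc ∑ i, |f i x| ≤ ∑ _i : Fin n, ‖q x‖ := Finset.sum_le_sum fun i _ => by
          rw [← hqi, ← Real.norm_eq_abs]; exact PiLp.norm_apply_le (q x) i
      _ = n * ‖q x‖ := by simp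
  have hnet : ∀ j : ℕ, ∃ (C : Finset (EuclideanSpace ℝ (Fin n))) (τ : ℝ),
      (C : Set (EuclideanSpace ℝ (Fin n))) ⊆ K ∧ C.card ≤ 2 ^ 2 ^ j ∧
      (∀ x ∈ K, ∃ c ∈ C, gauge T (x - c) ≤ τ) ∧
      (j < J → (2 : ℝ) ^ ((j : ℝ) / p) * τ ≤ 8 * L * (2 : ℝ) ^ ((l : ℝ) / p) * G) ∧
      ∀ i, j = i + J → (2 : ℝ) ^ ((j : ℝ) / p) * τ ≤ 2 * G * (1 / 2) ^ i := by
    intro j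
    rcases lt_or_ge j J with hj | hj
    -- Below level `l` the `L`-th power of a dual net has no room, and the single point `0` with
    -- radius `2 * G` suffices.
    · rcases lt_or_ge j l with hjl | hjl
      · refine ⟨{0}, 2 * G, by simpa using hK0, by simpa using Nat.one_le_two_pow,
          fun x hx => ⟨0, by simp, by simpa using hrad x hx⟩, fun _ => ?_, fun i hi => by omega⟩
        have h1 : (2 : ℝ) ^ ((j : ℝ) / p) ≤ (2 : ℝ) ^ ((l : ℝ) / p) := by
          refine Real.rpow_le_rpow_of_exponent_le (by norm_num) ?_
          gcongr
        calc (2 : ℝ) ^ ((j : ℝ) / p) * (2 * G) ≤ (2 : ℝ) ^ ((l : ℝ) / p) * (8 * L * G) := by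
              gcongr; linarith
          _ = _ := by ring
      -- Here `A i` is used: `(2 ^ 2 ^ i) ^ L ≤ 2 ^ 2 ^ (l + i)`. The `2 * m` in `L` pays for the
      -- two factors `n` lost to `q`, and the `a * J` for the factor `2 ^ (i / p)`.
      · obtain ⟨i, rfl⟩ := Nat.exists_eq_add_of_le hjl
        set ε := (2 : ℝ) ^ (-((i : ℝ) / p)) * G with hε
        have hε0 : 0 < ε := by positivity
        have hδL : 2 * ((n : ℝ) * (n * (2 * G))) ≤ 2 ^ L * (8 * L * ε) := by
          have h1 : (n : ℝ) * n * 2 ^ ((i : ℝ) / p) ≤ 2 ^ L := by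
            calc (n : ℝ) * n * 2 ^ ((i : ℝ) / p) ≤ 2 ^ m * 2 ^ m * 2 ^ (a * i) := by
                  gcongr; exact two_rpow_div_le hpa i
              _ = 2 ^ (2 * m + a * i) := by ring
              _ ≤ 2 ^ L := by
                  rw [hL]
                  refine pow_le_pow_right₀ (by norm_num) ?_
                  have : a * i ≤ a * J := Nat.mul_le_mul_left _ (by omega)
                  omega
          rw [hε, Real.rpow_neg (by norm_num)]
          have h2 : (n : ℝ) * n ≤ 2 ^ L * ((2 : ℝ) ^ ((i : ℝ) / p))⁻¹ := by
            rw [← div_eq_mul_inv, le_div_iff₀ (by positivity)]; exact h1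
          calc 2 * (n * (n * (2 * G))) = 4 * G * ((n : ℝ) * n) := by ring
            _ ≤ (8 * L * G) * (2 ^ L * ((2 : ℝ) ^ ((i : ℝ) / p))⁻¹) := by
                gcongr; linarith
            _ = _ := by ring
        have hS : ∀ z ∈ polarBody T, ∃ z' ∈ A i, ∀ y ∈ K, |inner ℝ (z - z') y| ≤ ε := by
          intro z hz
          obtain ⟨z', hz', hzz'⟩ := hA i z hz
          refine ⟨z', hz', fun y hy => abs_le.2 ⟨?_, ?_⟩⟩
          · have := inner_le_of_gauge_polarBody_le hKc.isBounded hzz' (hKs y hy)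
            rw [inner_neg_right] at this
            linarith
          · exact inner_le_of_gauge_polarBody_le hKc.isBounded hzz' hy
        obtain ⟨C, hCK, hCcard, hC⟩ := exists_net_of_polar_net hK hKc hK0 hT hTc.isClosed hT0 q
          (ρ := n * (2 * G)) (A := n) (by positivity) hqK (by positivity) hqT (A i) (ε := ε)
          (δ := 8 * L * ε) (L := L) hL1 (by positivity) (by field_simp; exact le_rfl) hδL hS
        refine ⟨C, 8 * L * ε, hCK, hCcard.trans ?_, hC, fun _ => le_of_eq ?_,
          fun i' hi' => by omega⟩
        · rw [hAcard, ← pow_mul]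
          refine Nat.pow_le_pow_right (by norm_num) ?_
          rw [pow_add, mul_comm]
          gcongr
        · have e : (2 : ℝ) ^ (((l + i : ℕ) : ℝ) / p) * (2 : ℝ) ^ (-((i : ℝ) / p)) =
              (2 : ℝ) ^ ((l : ℝ) / p) := by
            rw [← Real.rpow_add (by norm_num)]
            congr 1
            push_cast
            ring
          rw [hε, ← e]
          ring
    -- With `j = m + u`, a grid of `2 ^ 2 ^ u` values per coordinate fits, since `n ≤ 2 ^ m`. The
    -- choice of `J` forces `u ≥ m + 2 * a + 5`, so `2 ^ u` dominates all exponents that are linear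
    -- in `j`.
    · obtain ⟨u, hu⟩ := Nat.exists_eq_add_of_le (show m ≤ j by omega)
      have huk : a * j + m + 2 + j ≤ 2 ^ u := by
        have h5 : 2 * a + 5 ≤ u := by omega
        have hmu : m ≤ u := by omega
        refine le_trans ?_ (sq_le_two_pow (by omega))
        have h6 : a * m ≤ a * u := Nat.mul_le_mul_left _ hmu
        have h7 : (2 * a + 5) * u ≤ u * u := Nat.mul_le_mul_right _ h5
        rw [hu]
        nlinarith
      have hM1 : 2 ^ (2 ^ u - 1) ≤ 2 ^ 2 ^ u - 1 := by
        have h8 : 2 ^ 2 ^ u = 2 * 2 ^ (2 ^ u - 1) := by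
          rw [← pow_succ']; congr 1; have := Nat.one_le_two_pow (n := u); omega
        have h9 := Nat.one_le_two_pow (n := 2 ^ u - 1)
        omega
      have hM0 : 0 < 2 ^ 2 ^ u - 1 := lt_of_lt_of_le (by positivity) hM1
      obtain ⟨C, hCK, hCcard, hC⟩ := exists_net_of_coordinates f hf2
        (show 0 < 2 * G by positivity) hfK hM0
      refine ⟨C, _, hCK, hCcard.trans ?_, hC, fun h => by omega, fun i hi => ?_⟩
      · rw [Nat.sub_add_cancel Nat.one_le_two_pow, ← pow_mul]
        refine Nat.pow_le_pow_right (by norm_num) ?_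
        rw [hu, pow_add, mul_comm]
        gcongr
      · have hM0' : (0 : ℝ) < ((2 ^ 2 ^ u - 1 : ℕ) : ℝ) := Nat.cast_pos.2 hM0
        have key : (2 : ℝ) ^ (a * j) * 2 ^ m * 2 * 2 ^ i ≤ ((2 ^ 2 ^ u - 1 : ℕ) : ℝ) := by
          calc (2 : ℝ) ^ (a * j) * 2 ^ m * 2 * 2 ^ i = 2 ^ (a * j + m + 1 + i) := by ring
            _ ≤ 2 ^ (2 ^ u - 1) := pow_le_pow_right₀ (by norm_num) (by omega)
            _ ≤ _ := by exact_mod_cast hM1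
        have h10 := two_rpow_div_le hpa j
        rw [one_div, inv_pow, ← div_eq_mul_inv, le_div_iff₀ (by positivity)]
        calc (2 : ℝ) ^ ((j : ℝ) / p) * (n * (2 * (2 * G) / ((2 ^ 2 ^ u - 1 : ℕ) : ℝ))) * 2 ^ i
            ≤ 2 ^ (a * j) * (2 ^ m * (2 * (2 * G) / ((2 ^ 2 ^ u - 1 : ℕ) : ℝ))) * 2 ^ i := by
              gcongr
          _ = (2 : ℝ) ^ (a * j) * 2 ^ m * 2 * 2 ^ i / ((2 ^ 2 ^ u - 1 : ℕ) : ℝ) * (2 * G) := by ring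
          _ ≤ 1 * (2 * G) := by
              gcongr
              exact (div_le_one hM0').2 key
          _ = 2 * G := one_mul _
  choose C τ hCK hCcard hC hτ1 hτ2 using hnet
  exact bodyGamma_le_of_nets hinf (by positivity) (by positivity) hCK hCcard hC hτ1
    fun i => hτ2 (i + J) i rfl

/-- The integer parameters of `bodyGamma_le_of_bodyGamma_polarBody_lt` are `O (log (1 + n))`. -/
theorem exists_parameters {p : ℝ} (hp : 0 < p) :
    ∃ B : ℝ, 0 < B ∧ ∃ a : ℕ, 1 / p ≤ a ∧ ∀ n : ℕ, 1 ≤ n → ∃ m J L l : ℕ, n ≤ 2 ^ m ∧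
      J = 2 * m + (2 * a + 5) ∧ L = 2 * m + a * J ∧ L ≤ 2 ^ l ∧
      J * (8 * L * (2 : ℝ) ^ ((l : ℝ) / p)) + 4 ≤ B * Real.log (1 + n) ^ (2 + 1 / p) := by
  obtain ⟨a, ha⟩ := exists_nat_ge (1 / p)
  -- The constants come from `m ≤ 5 * Λ` and from `1 ≤ 2 * Λ`, which turns additive constants into
  -- multiples of `Λ = log (1 + n)`.
  set c₁ : ℝ := 10 + 2 * (2 * a + 5) with hc₁
  set c₂ : ℝ := 10 + a * c₁ with hc₂
  have hc₁0 : 0 < c₁ := by positivity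
  have hc₂0 : 0 < c₂ := by positivity
  refine ⟨c₁ * (8 * c₂ * (2 * c₂) ^ (1 / p)) + 4 * 2 ^ (2 + 1 / p), by positivity, a, ha,
    fun n hn => ?_⟩
  have hn' : (1 : ℝ) ≤ n := by exact_mod_cast hn
  set Λ := Real.log (1 + n) with hΛ
  have hlog2 : Real.log 2 ≤ Λ := Real.log_le_log (by norm_num) (by linarith)
  have hl2 := Real.log_two_gt_d9
  have hΛ1 : 1 / 2 ≤ Λ := by linarith
  have hΛ0 : 0 < Λ := by linarith
  set m := Nat.clog 2 n with hm
  set J := 2 * m + (2 * a + 5) with hJ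
  set L := 2 * m + a * J with hL
  have hmΛ : (m : ℝ) ≤ 5 * Λ := by
    rcases Nat.eq_zero_or_pos m with h0 | h0
    · rw [h0]; push_cast; positivity
    · have hn2 : 1 < n := by
        by_contra h
        have : n = 1 := by omega
        rw [hm, this] at h0
        simp at h0
      have h1 : 2 ^ (m - 1) < n := Nat.pow_pred_clog_lt_self (by norm_num) hn2
      have h2 : (2 : ℝ) ^ (m - 1) ≤ 1 + n := by
        have : (2 : ℝ) ^ (m - 1) < n := by exact_mod_cast h1
        linarith
      have h3 := Real.log_le_log (by positivity) h2
      rw [Real.log_pow, Nat.cast_sub h0, Nat.cast_one] at h3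
      have h4 : (m : ℝ) * (1 / 2) ≤ m * Real.log 2 := by gcongr; linarith
      nlinarith
  have hJΛ : (J : ℝ) ≤ c₁ * Λ := by
    rw [hJ, hc₁]
    push_cast
    have : (0 : ℝ) ≤ a := Nat.cast_nonneg a
    nlinarith
  have hLΛ : (L : ℝ) ≤ c₂ * Λ := by
    rw [hL, hc₂]
    push_cast
    have : (a : ℝ) * J ≤ a * (c₁ * Λ) := by gcongr
    nlinarith
  have ha1 : 1 ≤ a := by
    have : (0 : ℝ) < a := (one_div_pos.2 hp).trans_le ha
    exact_mod_cast this
  have hL2 : 1 < L := by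
    have : J ≤ a * J := Nat.le_mul_of_pos_left _ ha1
    omega
  refine ⟨m, J, L, Nat.clog 2 L, Nat.le_pow_clog (by norm_num) n, rfl, rfl,
    Nat.le_pow_clog (by norm_num) L, ?_⟩
  have h2l : (2 : ℝ) ^ Nat.clog 2 L ≤ 2 * (c₂ * Λ) := by
    have h1 : 2 ^ (Nat.clog 2 L - 1) < L := Nat.pow_pred_clog_lt_self (by norm_num) hL2
    have h2 : 0 < Nat.clog 2 L := Nat.clog_pos (by norm_num) hL2
    have h3 : 2 ^ Nat.clog 2 L = 2 * 2 ^ (Nat.clog 2 L - 1) := by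
      rw [← pow_succ']; congr 1; omega
    have h4 : (2 : ℝ) ^ Nat.clog 2 L ≤ 2 * L := by
      exact_mod_cast (by omega : 2 ^ Nat.clog 2 L ≤ 2 * L)
    linarith
  have h2lp : (2 : ℝ) ^ ((Nat.clog 2 L : ℝ) / p) ≤ (2 * c₂) ^ (1 / p) * Λ ^ (1 / p) := by
    rw [div_eq_mul_one_div, Real.rpow_mul (by norm_num), Real.rpow_natCast,
      ← Real.mul_rpow (by positivity) hΛ0.le]
    refine Real.rpow_le_rpow (by positivity) ?_ (by positivity)
    linarith
  have hone : 1 ≤ 2 ^ (2 + 1 / p) * Λ ^ (2 + 1 / p) := by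
    rw [← Real.mul_rpow (by norm_num) hΛ0.le]
    exact Real.one_le_rpow (by linarith) (by positivity)
  have hpow : Λ ^ (2 + 1 / p) = Λ * Λ * Λ ^ (1 / p) := by
    rw [Real.rpow_add hΛ0, Real.rpow_two, sq]
  calc J * (8 * L * (2 : ℝ) ^ ((Nat.clog 2 L : ℝ) / p)) + 4
      ≤ (c₁ * Λ) * (8 * (c₂ * Λ) * ((2 * c₂) ^ (1 / p) * Λ ^ (1 / p))) +
        4 * (2 ^ (2 + 1 / p) * Λ ^ (2 + 1 / p)) := by
        gcongr
        linarith
    _ = (c₁ * (8 * c₂ * (2 * c₂) ^ (1 / p)) + 4 * 2 ^ (2 + 1 / p)) * Λ ^ (2 + 1 / p) := by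
        rw [hpow]; ring

theorem theorem3 (p : ℝ) (hp : 0 < p) :
    ∃ C : ℝ, 0 < C ∧
      ∀ n : ℕ, 1 ≤ n →
        ∀ K T : ConvexBody (EuclideanSpace ℝ (Fin n)),
          IsSymmetricConvexBody K → IsSymmetricConvexBody T →
            bodyGamma p (K : Set (EuclideanSpace ℝ (Fin n))) T ≤
              ENNReal.ofReal (C * Real.log (1 + n) ^ (2 + 1 / p) *
                Real.log (Real.log (2 + n)) ^ (1 / p)) *
              bodyGamma p (polarBody (T : Set (EuclideanSpace ℝ (Fin n))))
                (polarBody (K : Set (EuclideanSpace ℝ (Fin n)))) := by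
  obtain ⟨B, hB, a, ha, hpar⟩ := exists_parameters hp
  -- As `n ≥ 1`, the iterated logarithm is at least `log (log 3) > 0`. The bound obtained has no
  -- such factor, and dividing the constant by `κ ^ (1 / p)` brings it to the stated form.
  have hlog3 : 1 < Real.log 3 := by
    rw [Real.lt_log_iff_exp_lt (by norm_num)]
    exact Real.exp_one_lt_d9.trans (by norm_num)
  set κ := Real.log (Real.log 3) with hκ
  have hκ0 : 0 < κ := Real.log_pos hlog3
  refine ⟨B / κ ^ (1 / p), by positivity, fun n hn K T hK hT => ?_⟩
  have hn' : (1 : ℝ) ≤ n := by exact_mod_cast hn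
  have hκn : κ ≤ Real.log (Real.log (2 + n)) :=
    Real.log_le_log (by linarith) (Real.log_le_log (by norm_num) (by linarith))
  have hΛ0 : 0 < Real.log (1 + n) := Real.log_pos (by linarith)
  set D := B / κ ^ (1 / p) * Real.log (1 + n) ^ (2 + 1 / p) *
    Real.log (Real.log (2 + n)) ^ (1 / p) with hD
  have hBD : B * Real.log (1 + n) ^ (2 + 1 / p) ≤ D := by
    calc B * Real.log (1 + n) ^ (2 + 1 / p)
        = B / κ ^ (1 / p) * Real.log (1 + n) ^ (2 + 1 / p) * κ ^ (1 / p) := by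
          field_simp
      _ ≤ D := by rw [hD]; gcongr
  have hD0 : 0 < D := lt_of_lt_of_le (by positivity) hBD
  obtain ⟨m, J, L, l, hm, hJ, hL, hl, hbound⟩ := hpar n hn
  rw [mul_comm, ← ENNReal.div_le_iff (by simpa using hD0) ENNReal.ofReal_ne_top]
  -- The infimum need not be attained and may be infinite, so the bound is proved for finite values
  -- `G'` above it.
  refine le_of_forall_gt fun G hG => ?_
  obtain ⟨G', hG1, hG2⟩ := exists_between hG
  have htop : G' ≠ ⊤ := hG2.ne_top
  refine lt_of_le_of_lt ?_ hG2
  rw [← ENNReal.ofReal_toReal htop] at hG1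
  have h := bodyGamma_le_of_bodyGamma_polarBody_lt hn K.convex K.isCompact hK.1 hK.2 T.convex
    T.isCompact hT.1 hT.2 hp ha hm hJ hL hl hG1
  rw [ENNReal.div_le_iff (by simpa using hD0) ENNReal.ofReal_ne_top]
  refine h.trans ?_
  conv_rhs => rw [← ENNReal.ofReal_toReal htop, mul_comm]
  rw [← ENNReal.ofReal_mul hD0.le]
  refine ENNReal.ofReal_le_ofReal ?_
  calc J * (8 * L * (2 : ℝ) ^ ((l : ℝ) / p) * G'.toReal) + 2 * (2 * G'.toReal)
      = (J * (8 * L * (2 : ℝ) ^ ((l : ℝ) / p)) + 4) * G'.toReal := by ring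
    _ ≤ D * G'.toReal := by
        gcongr
        exact hbound.trans hBD
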